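/- Let $n,m\ge 0$ and $k\ge 2$ be integers, with $n\ge 1$ if $k=2$. There is a constant $C_k>0$, depending only on $k$, $n$ and $m$, such that the following holds for every smooth embedded $n$-dimensional submanifold $M\subset\mathbb R^{n+m}$ without boundary, compact or not (that is, $M=\varphi(\mathcal M)$ for a smooth embedding $\varphi$ of a smooth $n$-dimensional manifold $\mathcal M$ without boundary). Let $d^M(y)=\inf_{z\in M}|y-z|$ and $A^M(y)=\tfrac12\left(|y|^2-d^M(y)^2\right)$ for $y\in\mathbb R^{n+m}$. Then $A^M$ is smooth in an open neighbourhood of $M$, and at every point $x\in M$ $$|A^k|^2\ \ge\ C_k\,|\mathrm B|^{2k-4}.$$ Here $|A^k|^2=\sum_{1\le i_1,\dots,i_k\le n+m}\left(\frac{\partial^k A^M}{\partial x_{i_1}\cdots\partial x_{i_k}}(x)\right)^2$. The second fundamental form of $M$ at $x$ is $\mathrm B(X,Y)=\left(\frac{\partial Y}{\partial X}(x)\right)^\perp$ for $X,Y\in T_xM$, where $Y$ is extended locally to a tangent vector field and $\perp$ is the projection on the normal space $N_xM$; it is extended to all $V,W\in\mathbb R^{n+m}$ by $\mathrm B(V,W)=\mathrm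 B(V^M,W^M)$, where $V^M$ is the orthogonal projection of $V$ on $T_xM$. Finally $|\mathrm B|^2=\sum_{i,j,l=1}^{n+m}\langle \mathrm B(e_i,e_j),e_l\rangle^2$ in the canonical basis, and $|\mathrm B|^0=1$ when $k=2$. -/

import Mathlib

open scoped Manifold ContDiff

noncomputable section

namespace SqDist

/-- Euclidean space of dimension `d`, with its standard scalar product. -/
abbrev Euc (d : ℕ) := EuclideanSpace ℝ (Fin d)

/-- The function `A^S(y) = (|y|² - d(y, S)²) / 2`, where `d(·, S)` is the distance function
from the set `S`. -/
def potential {d : ℕ} (S : Set (Euc d)) (y : Euc d) : ℝ :=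
  (‖y‖ ^ 2 - Metric.infDist y S ^ 2) / 2

/-- `|A^k(x)|²`: the sum over all `1 ≤ i₁, …, i_k ≤ d` of the squares of the partial derivatives
`∂^k A^S / ∂x_{i₁} ⋯ ∂x_{i_k}` at `x`. -/
def derivTensorNormSq {d : ℕ} (S : Set (Euc d)) (k : ℕ) (x : Euc d) : ℝ :=
  ∑ i : Fin k → Fin d,
    (iteratedFDeriv ℝ k (potential S) x fun l => EuclideanSpace.single (i l) (1 : ℝ)) ^ 2

section Submanifold

variable {n d : ℕ} {M : Type*} [TopologicalSpace M] [ChartedSpace (Euc n) M]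

/-- The local parametrization of the submanifold `φ(M)` around `φ p` given by the preferred chart
of `M` at `p`. -/
def localParam (φ : M → Euc d) (p : M) : Euc n → Euc d :=
  fun u => φ ((extChartAt (𝓡 n) p).symm u)

/-- The differential of `φ` at `p`, in the preferred chart at `p`. -/
def differential (φ : M → Euc d) (p : M) : Euc n →L[ℝ] Euc d :=
  fderiv ℝ (localParam φ p) (extChartAt (𝓡 n) p p)

/-- The tangent space `T_x M ⊆ ℝ^d` of the submanifold `φ(M)` at `x = φ p`. -/
def tangentSpace (φ : M → Euc d) (p : M) : Submodule ℝ (Euc d) :=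
  LinearMap.range (differential (n := n) φ p).toLinearMap

/-- A vector whose image under the differential of `φ` at `p` is the tangential projection `V^M`
of `V` (it is unique when `φ` is an immersion). -/
def tangentLift (φ : M → Euc d) (p : M) (V : Euc d) : Euc n :=
  Classical.choose
    (LinearMap.mem_range.1 ((tangentSpace (n := n) φ p).starProjection_apply_mem V))

/-- The vector valued second fundamental form at `x = φ p`, extended to all vectors of `ℝ^d` by
`B(V, W) = B(V^M, W^M)`. The tangent vector `W^M` is the value at `p` of the local tangent vector
field `Y = dφ(η)` with constant components `η` in the chart, and
`B(V^M, W^M) = (∂Y / ∂V^M)^⊥` is the normal part of its derivative in the direction `V^M`. -/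
def secondFundamentalForm (φ : M → Euc d) (p : M) (V W : Euc d) : Euc d :=
  (tangentSpace (n := n) φ p)ᗮ.starProjection
    (fderiv ℝ (fun u => fderiv ℝ (localParam φ p) u (tangentLift (n := n) φ p W))
      (extChartAt (𝓡 n) p p) (tangentLift (n := n) φ p V))

/-- The norm `|B| = (∑_{i,j,k} (B^k_{ij})²)^{1/2}`, where `B^k_{ij} = ⟨B(e_i, e_j), e_k⟩`. -/
def secondFundamentalFormNorm (n : ℕ) {d : ℕ} {M : Type*} [TopologicalSpace M]
    [ChartedSpace (Euc n) M] (φ : M → Euc d) (p : M) : ℝ :=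
  Real.sqrt (∑ i : Fin d, ∑ j : Fin d, ∑ k : Fin d,
    (secondFundamentalForm (n := n) φ p (EuclideanSpace.single i 1) (EuclideanSpace.single j 1) k)
      ^ 2)

end Submanifold

end SqDist

end

/-! Near `x` the set is the image of a chart `ψ`, and the gradient of the potential is the nearest
point projection `ψ ∘ g`. Here `g` solves the critical point equation of `u ↦ |y - ψ u|²`, so the
implicit function theorem makes it smooth. Let `ν` be normal at `x` and `X` a unit principal
direction of `⟨B, ν⟩` with principal curvature `l`. The projection is constant along the normal line
`x + tν`. Differentiating the critical equation there gives `Hess A (X, X) = 1 / (1 - t l)`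
(`eventually_hessian_potential`), and `j` derivatives in `t` at `0` give `A^{j+2}(ν, …, ν, X, X) =
j! l^j`. By Cauchy–Schwarz such a value is at most `|A^{j+2}|` when `|ν| ≤ 1`. Taking for `ν` the
normal part of `e_i` and for `l` the eigenvalue of largest modulus, each component of `B` is at most
`n |l|` in modulus (`exists_eigenvector_abs_le`). Summing components with `j = k - 2` gives the
bound for `k ≥ 3`. For `k = 2` the value is `1`. -/

namespace SqDist

open Filter Topology Set

/-! ### Implicit functions smooth on a neighbourhood. -/

/-- The implicit function theorem, with smoothness on a neighbourhood of the base point. -/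
theorem exists_implicitFunction_contDiffAt {E₁ E₂ F : Type*}
    [NormedAddCommGroup E₁] [NormedSpace ℝ E₁] [CompleteSpace E₁]
    [NormedAddCommGroup E₂] [NormedSpace ℝ E₂] [CompleteSpace E₂]
    [NormedAddCommGroup F] [NormedSpace ℝ F] [CompleteSpace F]
    {f : E₁ × E₂ → F} {u : E₁ × E₂} (hf : ∀ᶠ v in 𝓝 u, ContDiffAt ℝ ∞ f v)
    (hinv : (fderiv ℝ f u ∘L .inr ℝ E₁ E₂).IsInvertible) :
    ∃ g : E₁ → E₂, g u.1 = u.2 ∧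
      (∀ᶠ y in 𝓝 u.1, ContDiffAt ℝ ∞ g y ∧ f (y, g y) = f u) ∧
      ∀ᶠ v in 𝓝 u, f v = f u → g v.1 = v.2 := by
  have h0 : (∞ : WithTop ℕ∞) ≠ 0 := by simp
  have hfu := hf.self_of_nhds
  set g := hfu.implicitFunction h0 hinv with hg
  have hgu : g u.1 = u.2 := hfu.implicitFunction_apply_self h0 hinv
  have hiff := hfu.eventually_apply_eq_iff_implicitFunction h0 hinv
  have hgcont : ContinuousAt g u.1 := (hfu.contDiffAt_implicitFunction h0 hinv).continuousAt
  have hpair : Tendsto (fun y => (y, g y)) (𝓝 u.1) (𝓝 u) := by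
    have : ContinuousAt (fun y => (y, g y)) u.1 := continuousAt_id.prodMk hgcont
    simpa [ContinuousAt, hgu] using this
  have hfd : ContinuousAt (fun v => fderiv ℝ f v ∘L .inr ℝ E₁ E₂) u := by
    have := (hfu.fderiv_right (m := ∞) (by simp)).continuousAt
    exact this.clm_comp continuousAt_const
  have hinv' : ∀ᶠ v in 𝓝 u, (fderiv ℝ f v ∘L .inr ℝ E₁ E₂).IsInvertible := by
    obtain ⟨e, he⟩ := hinv
    have := hfd.eventually (he ▸ e.nhds)
    exact this
  refine ⟨g, hgu, ?_, hiff.mono fun v hv => hv.1⟩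
  have hgc : ∀ᶠ y in 𝓝 u.1, ContinuousAt g y :=
    ((hfu.contDiffAt_implicitFunction h0 hinv).of_le (m := 1) (by simp)).eventually (by simp)
      |>.mono fun y hy => hy.continuousAt
  filter_upwards [hpair.eventually hf, hpair.eventually hinv', hgc,
    hfu.eventually_apply_implicitFunction h0 hinv,
    hpair.eventually hiff.eventually_nhds] with y hfy hinvy hgy hval hiffy
  refine ⟨?_, hval⟩
  have hfg : f (y, g y) = f u := hval
  -- Being `C^∞` at one point only gives each finite order nearby. So the theorem is applied afresh
  -- at `(y, g y)`, and local uniqueness identifies the new function with `g` near `y`.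
  have hc := hfy.contDiffAt_implicitFunction h0 hinvy
  have hself := hfy.implicitFunction_apply_self h0 hinvy
  refine hc.congr_of_eventuallyEq ?_
  have ht : Tendsto (fun z => (z, hfy.implicitFunction h0 hinvy z)) (𝓝 y) (𝓝 (y, g y)) := by
    have : ContinuousAt (fun z => (z, hfy.implicitFunction h0 hinvy z)) y :=
      continuousAt_id.prodMk hc.continuousAt
    simpa [ContinuousAt, hself] using this
  filter_upwards [ht.eventually hiffy, hfy.eventually_apply_implicitFunction h0 hinvy] with z hz hz'
  exact hz.1 (hz'.trans hfg)

/-! ### Critical points of the distance to a parametrized set. -/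

section LocalParametrization

variable {E H : Type*} [NormedAddCommGroup E] [NormedSpace ℝ E]
  [NormedAddCommGroup H] [InnerProductSpace ℝ H]

/-- The differential of `u ↦ -|y - ψ u|² / 2`. -/
noncomputable def criticalMap (ψ : E → H) (v : H × E) : E →L[ℝ] ℝ :=
  (innerSL ℝ (v.1 - ψ v.2)) ∘L fderiv ℝ ψ v.2

theorem criticalMap_apply (ψ : E → H) (y : H) (u w : E) :
    criticalMap ψ (y, u) w = inner ℝ (y - ψ u) (fderiv ℝ ψ u w) := rfl

theorem contDiffAt_criticalMap {ψ : E → H} {v : H × E} (hψ : ContDiffAt ℝ ∞ ψ v.2) :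
    ContDiffAt ℝ ∞ (criticalMap ψ) v := by
  have h1 : ContDiffAt ℝ ∞ (fun v : H × E => ψ v.2) v := hψ.comp v contDiffAt_snd
  have h2 : ContDiffAt ℝ ∞ (fun v : H × E => fderiv ℝ ψ v.2) v :=
    (hψ.fderiv_right (m := ∞) (by simp)).comp v contDiffAt_snd
  unfold criticalMap
  exact ((innerSL ℝ (E := H)).contDiff.contDiffAt.comp v (contDiffAt_fst.sub h1)).clm_comp h2

/-- At the base point `y - ψ u₀ = 0` kills the second derivative of `ψ`, leaving minus the Gram
form, which is definite for an immersion. -/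
theorem fderiv_criticalMap_inr {ψ : E → H} {u₀ : E} (hψ : ContDiffAt ℝ ∞ ψ u₀) (w w' : E) :
    (fderiv ℝ (criticalMap ψ) (ψ u₀, u₀) ∘L .inr ℝ H E) w w' =
      -inner ℝ (fderiv ℝ ψ u₀ w) (fderiv ℝ ψ u₀ w') := by
  have hc : HasFDerivAt (criticalMap ψ) _ (ψ u₀, u₀) :=
    ((contDiffAt_criticalMap (v := (ψ u₀, u₀)) hψ).differentiableAt (by simp)).hasFDerivAt
  have hi : HasFDerivAt (fun u : E => (ψ u₀, u)) (.inr ℝ H E) u₀ := hasFDerivAt_prodMk_right _ _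
  have h1 := (hc.comp u₀ hi).clm_apply (hasFDerivAt_const w' u₀)
  have hd : HasFDerivAt ψ (fderiv ℝ ψ u₀) u₀ := (hψ.differentiableAt (by simp)).hasFDerivAt
  have hd2 := ((hψ.fderiv_right (m := ∞) (by simp)).differentiableAt (by simp)).hasFDerivAt
  have h2 := ((hd.const_sub (ψ u₀)).inner ℝ (hd2.clm_apply (hasFDerivAt_const w' u₀)))
  have h3 := congrArg (fun L => L w) (h1.unique h2)
  simpa using h3

variable [FiniteDimensional ℝ E]

theorem isInvertible_fderiv_criticalMap {ψ : E → H} {u₀ : E} (hψ : ContDiffAt ℝ ∞ ψ u₀)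
    (hinj : Function.Injective (fderiv ℝ ψ u₀)) :
    (fderiv ℝ (criticalMap ψ) (ψ u₀, u₀) ∘L .inr ℝ H E).IsInvertible := by
  set L := fderiv ℝ (criticalMap ψ) (ψ u₀, u₀) ∘L .inr ℝ H E with hL
  have hLinj : Function.Injective L := by
    refine (injective_iff_map_eq_zero L).2 fun w hw => ?_
    have := fderiv_criticalMap_inr hψ w w
    rw [← hL, hw] at this
    have h0 : fderiv ℝ ψ u₀ w = 0 := by simpa using this.symm
    exact (injective_iff_map_eq_zero _).1 hinj w h0
  have hfr : Module.finrank ℝ E = Module.finrank ℝ (E →L[ℝ] ℝ) := by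
    rw [← (LinearMap.toContinuousLinearMap (𝕜 := ℝ) (E := E) (F' := ℝ)).finrank_eq]
    exact (Subspace.dual_finrank_eq (K := ℝ) (V := E)).symm
  exact ⟨(LinearEquiv.ofInjectiveOfFinrankEq L.toLinearMap hLinj hfr).toContinuousLinearEquiv,
    by ext; rfl⟩

theorem exists_criticalPoint [FiniteDimensional ℝ H] {ψ : E → H} {u₀ : E} (hψ : ∀ᶠ u in 𝓝 u₀, ContDiffAt ℝ ∞ ψ u)
    (hinj : Function.Injective (fderiv ℝ ψ u₀)) :
    ∃ g : H → E, g (ψ u₀) = u₀ ∧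
      (∀ᶠ y in 𝓝 (ψ u₀), ContDiffAt ℝ ∞ g y ∧ criticalMap ψ (y, g y) = 0) ∧
      ∀ᶠ v in 𝓝 (ψ u₀, u₀), criticalMap ψ v = 0 → g v.1 = v.2 := by
  have h0 : criticalMap ψ (ψ u₀, u₀) = 0 := by simp [criticalMap]
  have := exists_implicitFunction_contDiffAt (f := criticalMap ψ) (u := (ψ u₀, u₀))
    ((continuous_snd.tendsto (ψ u₀, u₀)).eventually hψ |>.mono fun v hv =>
      contDiffAt_criticalMap hv) (isInvertible_fderiv_criticalMap hψ.self_of_nhds hinj)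
  simpa only [h0] using this

/-- Near a point of a locally parametrized set, the distance is attained at the
locally unique critical point. -/
theorem eventually_infDist_eq {ψ : E → H} {u₀ : E} {S : Set H} {g : H → E}
    (hψ : ∀ᶠ u in 𝓝 u₀, ContDiffAt ℝ ∞ ψ u) (hS : ∀ᶠ u in 𝓝 u₀, ψ u ∈ S)
    (hnhds : ∀ V ∈ 𝓝 u₀, ψ '' V ∈ 𝓝[S] (ψ u₀))
    (hg : ∀ᶠ v in 𝓝 (ψ u₀, u₀), criticalMap ψ v = 0 → g v.1 = v.2) :
    ∀ᶠ y in 𝓝 (ψ u₀), Metric.infDist y S = ‖y - ψ (g y)‖ := by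
  rw [nhds_prod_eq] at hg
  obtain ⟨P, hP, Q, hQ, hPQ⟩ := eventually_prod_iff.1 hg
  obtain ⟨ρ, hρ, hball⟩ := Metric.nhds_basis_closedBall.eventually_iff.1
    ((hψ.eventually_nhds.and hS.eventually_nhds).and hQ)
  set K := Metric.closedBall u₀ ρ
  have hKc : IsCompact (ψ '' K) := (isCompact_closedBall u₀ ρ).image_of_continuousOn
    fun u hu => (hball hu).1.1.self_of_nhds.continuousAt.continuousWithinAt
  have hxK : ψ u₀ ∈ ψ '' K := mem_image_of_mem _ (Metric.mem_closedBall_self hρ.le)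
  have hKS : ψ '' K ⊆ S := by
    rintro _ ⟨u, hu, rfl⟩
    exact (hball hu).1.2.self_of_nhds
  obtain ⟨r, hr, hrS⟩ := Metric.mem_nhdsWithin_iff.1 (hnhds K (Metric.closedBall_mem_nhds u₀ hρ))
  -- With `y` within `r / 2` of `ψ u₀`, points of `S` outside the `r`-ball are farther from `y` than
  -- `ψ u₀` is.
  filter_upwards [hP, Metric.ball_mem_nhds (ψ u₀) (half_pos hr)] with y hy hyr
  obtain ⟨_, ⟨u, hu, rfl⟩, hmin⟩ := hKc.exists_infDist_eq_dist ⟨_, hxK⟩ y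
  have hle : ∀ z ∈ S, dist y (ψ u) ≤ dist y z := by
    intro z hz
    rw [← hmin]
    by_cases hzr : z ∈ Metric.ball (ψ u₀) r
    · exact Metric.infDist_le_dist_of_mem (hrS ⟨hzr, hz⟩)
    · refine (Metric.infDist_le_dist_of_mem hxK).trans ?_
      rw [Metric.mem_ball] at hyr hzr
      have := dist_triangle z y (ψ u₀)
      rw [dist_comm z y] at this
      linarith
  have hcrit : criticalMap ψ (y, u) = 0 := by
    -- `u` may lie on the boundary of `K`; it is still a local minimum because `ψ` maps a full
    -- neighbourhood of `u` into `S`.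
    have hloc : IsLocalMin (fun u' => ‖y - ψ u'‖ ^ 2) u := by
      filter_upwards [(hball hu).1.2] with u' hu'
      have := hle _ hu'
      rw [dist_eq_norm, dist_eq_norm] at this
      gcongr
    have hd : HasFDerivAt ψ (fderiv ℝ ψ u) u :=
      ((hball hu).1.1.self_of_nhds.differentiableAt (by simp)).hasFDerivAt
    have h := hloc.hasFDerivAt_eq_zero (hd.const_sub y).norm_sq
    ext w
    have := congrArg (fun L => L w) h
    rw [criticalMap_apply]
    simpa [inner_sub_left, sub_eq_zero, eq_comm (a := inner ℝ y _)] using this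
  have hgy : g y = u := hPQ hy (hball hu).2 hcrit
  rw [hgy, ← dist_eq_norm]
  refine le_antisymm (Metric.infDist_le_dist_of_mem (hKS (mem_image_of_mem _ hu))) ?_
  exact (Metric.le_infDist ⟨_, hKS hxK⟩).2 fun z hz => hle z hz

end LocalParametrization

/-! ### Gradient, Hessian and higher derivatives of the potential. -/

section Potential

variable {E : Type*} [NormedAddCommGroup E] [NormedSpace ℝ E] {d : ℕ}

/-- Expanding the square cancels `|y|²` and leaves an expression as smooth as the projection `h`. -/
theorem potential_eventuallyEq {S : Set (Euc d)} {h : Euc d → Euc d} {x : Euc d}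
    (hdist : ∀ᶠ y in 𝓝 x, Metric.infDist y S = ‖y - h y‖) :
    potential S =ᶠ[𝓝 x] fun y => inner ℝ y (h y) - ‖h y‖ ^ 2 / 2 := by
  filter_upwards [hdist] with y hy
  rw [potential, hy, norm_sub_sq_real]
  ring

theorem eventually_contDiffAt_potential {S : Set (Euc d)} {ψ : E → Euc d} {g : Euc d → E}
    {x : Euc d} (hψ : ∀ᶠ y in 𝓝 x, ContDiffAt ℝ ∞ ψ (g y))
    (hg : ∀ᶠ y in 𝓝 x, ContDiffAt ℝ ∞ g y)
    (hdist : ∀ᶠ y in 𝓝 x, Metric.infDist y S = ‖y - ψ (g y)‖) :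
    ∀ᶠ y in 𝓝 x, ContDiffAt ℝ ∞ (potential S) y := by
  filter_upwards [hψ, hg, hdist.eventually_nhds] with y h1 h2 h3
  refine ContDiffAt.congr_of_eventuallyEq ?_ (potential_eventuallyEq h3)
  have h4 : ContDiffAt ℝ ∞ (fun y => ψ (g y)) y := h1.comp y h2
  exact (contDiffAt_id.inner ℝ h4).sub (h4.norm_sq ℝ |>.div_const 2)

/-- The gradient of the potential is the nearest point projection. -/
theorem eventually_fderiv_potential {S : Set (Euc d)} {ψ : E → Euc d} {g : Euc d → E}
    {x : Euc d} (hψ : ∀ᶠ y in 𝓝 x, ContDiffAt ℝ ∞ ψ (g y))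
    (hg : ∀ᶠ y in 𝓝 x, ContDiffAt ℝ ∞ g y)
    (hcrit : ∀ᶠ y in 𝓝 x, criticalMap ψ (y, g y) = 0)
    (hdist : ∀ᶠ y in 𝓝 x, Metric.infDist y S = ‖y - ψ (g y)‖) :
    ∀ᶠ y in 𝓝 x, fderiv ℝ (potential S) y = innerSL ℝ (ψ (g y)) := by
  filter_upwards [hψ, hg, hcrit, hdist.eventually_nhds] with y h1 h2 hc h3
  have h4 : HasFDerivAt (fun y => ψ (g y)) (fderiv ℝ ψ (g y) ∘L fderiv ℝ g y) y :=
    (h1.differentiableAt (by simp)).hasFDerivAt.comp y (h2.differentiableAt (by simp)).hasFDerivAt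
  have h5 := ((hasFDerivAt_id y).inner ℝ h4).sub (h4.norm_sq.const_mul (1 / 2))
  have h6 : HasFDerivAt (potential S) _ y := h5.congr_of_eventuallyEq (by
    filter_upwards [potential_eventuallyEq h3] with z hz
    simp only [hz, id, Pi.sub_apply]
    ring)
  rw [h6.fderiv]
  ext v
  -- Criticality cancels every term containing the derivative of the projection.
  have hcv := congrArg (fun L => L (fderiv ℝ g y v)) hc
  simp only [criticalMap_apply, inner_sub_left, zero_apply] at hcv
  simp [real_inner_comm v]
  linarith

/-- The Hessian of the potential along a normal line, in a principal direction. -/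
theorem eventually_hessian_potential {S : Set (Euc d)} {ψ : E → Euc d} {g : Euc d → E} {u₀ : E}
    (hψ : ∀ᶠ y in 𝓝 (ψ u₀), ContDiffAt ℝ ∞ ψ (g y))
    (hg : ∀ᶠ y in 𝓝 (ψ u₀), ContDiffAt ℝ ∞ g y)
    (hcrit : ∀ᶠ y in 𝓝 (ψ u₀), criticalMap ψ (y, g y) = 0)
    (huniq : ∀ᶠ v in 𝓝 (ψ u₀, u₀), criticalMap ψ v = 0 → g v.1 = v.2)
    (hdist : ∀ᶠ y in 𝓝 (ψ u₀), Metric.infDist y S = ‖y - ψ (g y)‖)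
    {ν : Euc d} (hν : ∀ w, inner ℝ ν (fderiv ℝ ψ u₀ w) = 0) {a : E} {l : ℝ}
    (hl : ∀ w, inner ℝ ν (fderiv ℝ (fderiv ℝ ψ) u₀ w a) =
      l * inner ℝ (fderiv ℝ ψ u₀ w) (fderiv ℝ ψ u₀ a)) :
    ∀ᶠ t in 𝓝 (0 : ℝ), (1 - t * l) * fderiv ℝ (fderiv ℝ (potential S)) (ψ u₀ + t • ν)
      (fderiv ℝ ψ u₀ a) (fderiv ℝ ψ u₀ a) = ‖fderiv ℝ ψ u₀ a‖ ^ 2 := by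
  have hline : Tendsto (fun t : ℝ => ψ u₀ + t • ν) (𝓝 0) (𝓝 (ψ u₀)) := by
    have : Continuous (fun t : ℝ => ψ u₀ + t • ν) := by fun_prop
    simpa using this.tendsto 0
  have huniq' : ∀ᶠ y in 𝓝 (ψ u₀), criticalMap ψ (y, u₀) = 0 → g y = u₀ :=
    (show Continuous (fun y : Euc d => (y, u₀)) by fun_prop).tendsto (ψ u₀) |>.eventually huniq
  have hgrad := eventually_fderiv_potential hψ hg hcrit hdist
  filter_upwards [hline.eventually hψ, hline.eventually hg,
    hline.eventually hcrit.eventually_nhds, hline.eventually huniq',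
    hline.eventually hgrad.eventually_nhds] with t h1 h2 h3 h4 h5
  set y := ψ u₀ + t • ν with hy
  set X := fderiv ℝ ψ u₀ a
  -- As `ν` is normal, `u₀` is critical for every `y` on the line, hence equals `g y` by uniqueness.
  have hgy : g y = u₀ := by
    refine h4 ?_
    ext w
    simp [criticalMap_apply, hy, inner_smul_left, hν]
  rw [hgy] at h1
  have hdg : HasFDerivAt g (fderiv ℝ g y) y := (h2.differentiableAt (by simp)).hasFDerivAt
  set w := fderiv ℝ g y X
  have hdψ : HasFDerivAt ψ (fderiv ℝ ψ u₀) (g y) := by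
    rw [hgy]; exact (h1.differentiableAt (by simp)).hasFDerivAt
  have hddψ : HasFDerivAt (fderiv ℝ ψ) (fderiv ℝ (fderiv ℝ ψ) u₀) (g y) := by
    rw [hgy]
    exact ((h1.fderiv_right (m := ∞) (by simp)).differentiableAt (by simp)).hasFDerivAt
  have hπ := hdψ.comp y hdg
  have hhess : fderiv ℝ (fderiv ℝ (potential S)) y X X = inner ℝ (fderiv ℝ ψ u₀ w) X := by
    have hd : HasFDerivAt (fderiv ℝ (potential S)) _ y :=
      ((innerSL ℝ (E := Euc d)).hasFDerivAt.comp y hπ).congr_of_eventuallyEq h5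
    rw [hd.fderiv]
    rfl
  -- This is the identity `⟨y - ψ (g y), dψ (g y) a⟩ = 0` differentiated in the direction `X`.
  have hzero : inner ℝ (X - fderiv ℝ ψ u₀ w) X + t * inner ℝ ν (fderiv ℝ (fderiv ℝ ψ) u₀ w a)
      = 0 := by
    have hd := ((hasFDerivAt_id y).sub hπ).inner ℝ
      ((hddψ.comp y hdg).clm_apply (hasFDerivAt_const a y))
    have hz : HasFDerivAt (fun _ : Euc d => (0 : ℝ)) _ y := hd.congr_of_eventuallyEq (by
      filter_upwards [h3] with z hz
      have := congrArg (fun L => L a) hz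
      exact this.symm)
    have := congrArg (fun L => L X) (hz.unique (hasFDerivAt_const 0 y))
    simp [hgy] at this
    simp [hy, inner_smul_left] at this
    linarith
  rw [hl, inner_sub_left, real_inner_self_eq_norm_sq] at hzero
  rw [hhess]
  linarith

/-- Iterated derivatives of a function whose Hessian along a line is `c / (1 - t l)`. -/
theorem eventually_iteratedFDeriv_line {F : Type*} [NormedAddCommGroup F] [NormedSpace ℝ F]
    {A : F → ℝ} {x ν X : F} {c l : ℝ} (hA : ∀ᶠ y in 𝓝 x, ContDiffAt ℝ ∞ A y)
    (h : ∀ᶠ t in 𝓝 (0 : ℝ), (1 - t * l) * fderiv ℝ (fderiv ℝ A) (x + t • ν) X X = c) (j : ℕ) :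
    ∀ᶠ t in 𝓝 (0 : ℝ), iteratedFDeriv ℝ (j + 2) A (x + t • ν)
      (fun i => if i.val < j then ν else X) = j.factorial * l ^ j * c / (1 - t * l) ^ (j + 1) := by
  have hne : ∀ᶠ t in 𝓝 (0 : ℝ), 1 - t * l ≠ 0 :=
    (show Continuous (fun t : ℝ => 1 - t * l) by fun_prop).tendsto 0 |>.eventually_ne (by simp)
  have hline : Tendsto (fun t : ℝ => x + t • ν) (𝓝 0) (𝓝 x) := by
    have : Continuous (fun t : ℝ => x + t • ν) := by fun_prop
    simpa using this.tendsto 0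
  induction j with
  | zero =>
    filter_upwards [h, hne] with t ht ht0
    rw [iteratedFDeriv_two_apply]
    simp only [Nat.not_lt_zero, if_false, Nat.factorial_zero, Nat.cast_one, pow_zero, one_mul,
      zero_add, pow_one]
    rw [eq_div_iff ht0, mul_comm, ht]
  | succ j ih =>
    filter_upwards [ih.eventually_nhds, hne, hline.eventually hA] with t ht ht0 hAt
    have hj : 1 + ((j + 2 : ℕ) : WithTop ℕ∞) ≤ ∞ := by
      exact_mod_cast ENat.natCast_le_of_coe_top_le_withTop le_rfl (1 + (j + 2))
    have hd : HasFDerivAt (iteratedFDeriv ℝ (j + 2) A)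
        (fderiv ℝ (iteratedFDeriv ℝ (j + 2) A) (x + t • ν)) (x + t • ν) :=
      ((hAt.iteratedFDeriv_right hj).differentiableAt (by simp)).hasFDerivAt
    have hdl : HasDerivAt (fun t : ℝ => x + t • ν) ν t := by
      simpa using ((hasDerivAt_id t).smul_const ν).const_add x
    have h1 := (hd.comp_hasDerivAt t hdl)
    have h2 := ((ContinuousMultilinearMap.apply ℝ (fun _ : Fin (j + 2) => F) ℝ
      (fun i => if i.val < j then ν else X)).hasFDerivAt.comp_hasDerivAt t h1)
    have h3 : HasDerivAt (fun t : ℝ => j.factorial * l ^ j * c / (1 - t * l) ^ (j + 1)) _ t :=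
      h2.congr_of_eventuallyEq (ht.mono fun s hs => hs.symm)
    have h4 : HasDerivAt (fun t : ℝ => 1 - t * l) (-l) t := by
      simpa using ((hasDerivAt_id t).mul_const l).const_sub 1
    have h5 := ((hasDerivAt_const t (j.factorial * l ^ j * c)).div (h4.pow (j + 1))
      (pow_ne_zero _ ht0))
    have h6 := h3.unique h5
    rw [iteratedFDeriv_succ_apply_left]
    have htail : Fin.tail (fun i : Fin (j + 1 + 2) => if i.val < j + 1 then ν else X) =
        fun i : Fin (j + 2) => if i.val < j then ν else X := by
      ext i
      simp [Fin.tail]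
    rw [htail]
    simp only [ContinuousMultilinearMap.apply_apply] at h6
    refine Eq.trans ?_ (h6.trans ?_)
    · simp
    · rw [Nat.factorial_succ]
      simp only [Pi.pow_apply]
      generalize 1 - t * l = s at ht0
      push_cast
      field_simp
      ring

end Potential

/-! ### Linear algebra: tensor norms and eigenvalues. -/

/-- Cauchy–Schwarz on the expansion in the canonical basis: the squared coefficients sum to `∏
|v_l|² ≤ 1`. -/
theorem sq_apply_le_sum_sq_apply_single {d k : ℕ}
    (T : ContinuousMultilinearMap ℝ (fun _ : Fin k => Euc d) ℝ) (v : Fin k → Euc d)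
    (hv : ∀ l, ‖v l‖ ≤ 1) :
    T v ^ 2 ≤ ∑ i : Fin k → Fin d, T (fun l => EuclideanSpace.single (i l) 1) ^ 2 := by
  have hT : T v = ∑ i : Fin k → Fin d,
      (∏ l, v l (i l)) * T (fun l => EuclideanSpace.single (i l) 1) := by
    have hexp : v = fun l => ∑ j, v l j • EuclideanSpace.single j (1 : ℝ) := by
      ext l j
      simp [Pi.single_apply]
    conv_lhs => rw [hexp]
    rw [ContinuousMultilinearMap.map_sum]
    exact Finset.sum_congr rfl fun i _ => by
      rw [ContinuousMultilinearMap.map_smul_univ, smul_eq_mul]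
  have hprod : ∑ i : Fin k → Fin d, (∏ l, v l (i l)) ^ 2 ≤ 1 := by
    simp only [← Finset.prod_pow]
    rw [← Fintype.piFinset_univ, Finset.sum_prod_piFinset (Finset.univ) (fun l j => v l j ^ 2)]
    refine Finset.prod_le_one (fun l _ => Finset.sum_nonneg fun j _ => sq_nonneg _) fun l _ => ?_
    have h1 := EuclideanSpace.real_norm_sq_eq (v l)
    rw [← h1]
    exact pow_le_one₀ (norm_nonneg _) (hv l)
  rw [hT]
  refine (Finset.sum_mul_sq_le_sq_mul_sq _ _ _).trans ?_
  exact mul_le_of_le_one_left (Finset.sum_nonneg fun i _ => sq_nonneg _) hprod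

/-- A symmetric bilinear form is controlled by one of its eigenvalues with respect to the scalar
product pulled back by an injective linear map. -/
theorem exists_eigenvector_abs_le {E H : Type*} [AddCommGroup E] [Module ℝ E]
    [FiniteDimensional ℝ E] [NormedAddCommGroup H] [InnerProductSpace ℝ H] (D : E →ₗ[ℝ] H)
    (hD : Function.Injective D) (b : E →ₗ[ℝ] E →ₗ[ℝ] ℝ) (hb : ∀ w w', b w w' = b w' w)
    {w w' : E} (hw : ‖D w‖ ≤ 1) (hw' : ‖D w'‖ ≤ 1) (hne : b w w' ≠ 0) :
    ∃ (a : E) (l : ℝ), ‖D a‖ = 1 ∧ (∀ z, b z a = l * inner ℝ (D z) (D a)) ∧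
      |b w w'| ≤ Module.finrank ℝ E * |l| := by
  let e : E ≃ₗ[ℝ] D.range := LinearEquiv.ofInjective D hD
  have he : ∀ z, ((e z : D.range) : H) = D z := fun z => rfl
  let q := stdOrthonormalBasis ℝ D.range
  let T : D.range →ₗ[ℝ] D.range :=
    ∑ i, ((b.flip (e.symm (q i))) ∘ₗ e.symm.toLinearMap).smulRight (q i)
  have hT : ∀ X Y, inner ℝ (T X) Y = b (e.symm X) (e.symm Y) := by
    intro X Y
    conv_rhs => rw [← q.sum_repr Y]
    simp [T, sum_inner, inner_smul_left, q.repr_apply_apply, mul_comm]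
  have hsymm : T.IsSymmetric := by
    intro X Y
    rw [hT, ← real_inner_comm, hT, hb]
  have hfr : Module.finrank ℝ D.range = Module.finrank ℝ E := e.finrank_eq.symm
  let v := hsymm.eigenvectorBasis hfr
  let μ := hsymm.eigenvalues hfr
  have hTv : ∀ i, T (v i) = μ i • v i := hsymm.apply_eigenvectorBasis hfr
  -- A nonzero value of `b` rules out dimension zero, where no unit eigenvector exists.
  have hpos : 0 < Module.finrank ℝ E := by
    refine Module.finrank_pos_iff_exists_ne_zero.2 ⟨w, ?_⟩
    rintro rfl
    simp at hne
  have : Nonempty (Fin (Module.finrank ℝ E)) := ⟨⟨0, hpos⟩⟩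
  obtain ⟨i, -, hi⟩ := Finset.exists_max_image Finset.univ (fun i => |μ i|) Finset.univ_nonempty
  refine ⟨e.symm (v i), μ i, ?_, fun z => ?_, ?_⟩
  · rw [← he, e.apply_symm_apply]
    exact v.orthonormal.1 i
  · have h1 := hT (v i) (e z)
    rw [hTv, inner_smul_left, e.symm_apply_apply, hb] at h1
    rw [← h1, ← he, ← he, e.apply_symm_apply, ← Submodule.coe_inner, real_inner_comm]
    rfl
  · have h1 : b w w' = ∑ j, μ j * (inner ℝ (v j) (e w) * inner ℝ (v j) (e w')) := by
      have := hT (e w) (e w')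
      rw [e.symm_apply_apply, e.symm_apply_apply] at this
      rw [← this, ← v.sum_inner_mul_inner]
      refine Finset.sum_congr rfl fun j _ => ?_
      rw [hsymm, hTv, inner_smul_right, real_inner_comm]
      ring
    rw [h1]
    refine (Finset.abs_sum_le_sum_abs _ _).trans ?_
    have hterm : ∀ j, |μ j * (inner ℝ (v j) (e w) * inner ℝ (v j) (e w'))| ≤ |μ i| := by
      intro j
      have hin : ∀ z : E, ‖D z‖ ≤ 1 → |inner ℝ (v j) (e z)| ≤ 1 := fun z hz => by
        refine (abs_real_inner_le_norm _ _).trans ?_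
        rw [v.orthonormal.1 j, one_mul]
        exact hz
      rw [abs_mul, abs_mul]
      refine (mul_le_of_le_one_right (abs_nonneg _) ?_).trans (hi j (Finset.mem_univ j))
      exact mul_le_one₀ (hin w hw) (abs_nonneg _) (hin w' hw')
    refine (Finset.sum_le_card_nsmul _ _ _ fun j _ => hterm j).trans ?_
    simp

/-! ### Embedded submanifolds and the curvature estimate. -/

section

variable {n d : ℕ} {M : Type*} [TopologicalSpace M] [ChartedSpace (Euc n) M]

theorem eventually_contDiffAt_localParam [IsManifold (𝓡 n) ∞ M] {φ : M → Euc d}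
    (hφ : ContMDiff (𝓡 n) 𝓘(ℝ, Euc d) ∞ φ) (p : M) :
    ∀ᶠ u in 𝓝 (extChartAt (𝓡 n) p p), ContDiffAt ℝ ∞ (localParam φ p) u := by
  have hopen : IsOpen (extChartAt (𝓡 n) p).target := isOpen_extChartAt_target p
  filter_upwards [hopen.mem_nhds (mem_extChartAt_target p)] with u hu
  have h1 : ContMDiffOn 𝓘(ℝ, Euc n) 𝓘(ℝ, Euc d) ∞ (localParam φ p) (extChartAt (𝓡 n) p).target :=
    hφ.comp_contMDiffOn (contMDiffOn_extChartAt_symm p)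
  exact (contMDiffOn_iff_contDiffOn.1 h1).contDiffAt (hopen.mem_nhds hu)

theorem localParam_extChartAt_self (φ : M → Euc d) (p : M) :
    localParam φ p (extChartAt (𝓡 n) p p) = φ p := by
  simp [localParam]

/-- This is where the embedding hypothesis enters: no other sheet of the image accumulates at `φ p`.
-/
theorem image_localParam_mem_nhdsWithin {φ : M → Euc d} (hφ : IsEmbedding φ) (p : M)
    {V : Set (Euc n)} (hV : V ∈ 𝓝 (extChartAt (𝓡 n) p p)) :
    localParam φ p '' V ∈ 𝓝[range φ] (localParam φ p (extChartAt (𝓡 n) p p)) := by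
  rw [localParam_extChartAt_self, ← hφ.map_nhds_eq, mem_map]
  filter_upwards [(continuousAt_extChartAt (I := 𝓡 n) p).preimage_mem_nhds hV,
    extChartAt_source_mem_nhds (I := 𝓡 n) p] with q hq hqs
  exact ⟨extChartAt (𝓡 n) p q, hq, by rw [localParam, (extChartAt (𝓡 n) p).left_inv hqs]⟩

theorem injective_differential [IsManifold (𝓡 n) ∞ M] {φ : M → Euc d} {p : M}
    (hφ : Manifold.IsImmersionAt (𝓡 n) 𝓘(ℝ, Euc d) ∞ φ p)
    (hdiff : DifferentiableAt ℝ (localParam φ p) (extChartAt (𝓡 n) p p)) :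
    Function.Injective (differential (n := n) φ p) := by
  let c := hφ.domChart.extend (𝓡 n)
  let c' := hφ.codChart.extend 𝓘(ℝ, Euc d)
  let τ : Euc n → Euc n := extChartAt (𝓡 n) p ∘ c.symm
  have hps := hφ.mem_domChart_source
  have hpc : p ∈ c.source := by rwa [OpenPartialHomeomorph.extend_source]
  have hcp : c.symm (c p) = p := c.left_inv hpc
  have htarget : c.target ∈ 𝓝 (c p) :=
    hφ.domChart.isOpen_extend_target.mem_nhds (c.map_source hpc)
  have hτp : τ (c p) = extChartAt (𝓡 n) p p := by simp [τ, hcp]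
  have hτ : DifferentiableAt ℝ τ (c p) := by
    have h1 : ContMDiffAt 𝓘(ℝ, Euc n) (𝓡 n) ∞ c.symm (c p) :=
      contMDiffOn_extend_symm hφ.domChart_mem_maximalAtlas |>.contMDiffAt
        (by rwa [← hφ.domChart.extend_target'])
    have h2 : ContMDiffAt (𝓡 n) 𝓘(ℝ, Euc n) ∞ (extChartAt (𝓡 n) p) (c.symm (c p)) := by
      rw [hcp]; exact contMDiffAt_extChartAt
    exact (contMDiffAt_iff_contDiffAt.1 (h2.comp _ h1)).differentiableAt (by simp)
  have hc' : DifferentiableAt ℝ c' (φ p) :=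
    (contMDiffAt_iff_contDiffAt.1 (contMDiffAt_of_mem_maximalAtlas hφ.codChart_mem_maximalAtlas
      hφ.mem_codChart_source)).differentiableAt (by simp)
  let L : Euc n →L[ℝ] Euc d := hφ.equiv.toContinuousLinearMap ∘L .inl ℝ _ _
  have hL : Function.Injective L := fun a b hab => by
    simpa [L] using hab
  have hev : c' ∘ localParam φ p ∘ τ =ᶠ[𝓝 (c p)] L := by
    have hsrc : ∀ᶠ u in 𝓝 (c p), c.symm u ∈ (extChartAt (𝓡 n) p).source := by
      have : ContinuousAt c.symm (c p) := hφ.domChart.continuousAt_extend_symm hps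
      refine this.eventually_mem ?_
      rw [hcp]; exact extChartAt_source_mem_nhds p
    filter_upwards [htarget, hsrc] with u hu hus
    have := hφ.writtenInCharts hu
    simp only [Function.comp_apply, localParam, τ] at this ⊢
    rw [(extChartAt (𝓡 n) p).left_inv hus]
    exact this
  have hcomp : fderiv ℝ c' (φ p) ∘L differential (n := n) φ p ∘L fderiv ℝ τ (c p) = L := by
    have h1 : HasFDerivAt (localParam φ p) (differential (n := n) φ p) (τ (c p)) := by
      rw [hτp]; exact hdiff.hasFDerivAt
    have h2 := h1.comp _ hτ.hasFDerivAt
    have h3 : HasFDerivAt c' (fderiv ℝ c' (φ p)) ((localParam φ p ∘ τ) (c p)) := by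
      rw [Function.comp_apply, hτp, localParam_extChartAt_self]; exact hc'.hasFDerivAt
    exact ((h3.comp _ h2).congr_of_eventuallyEq hev.symm).unique L.hasFDerivAt
  -- The injective `L` factors through `dτ`, which is therefore injective, and bijective by equality
  -- of dimensions; so the middle factor is injective too.
  have hτinj : Function.Injective (fderiv ℝ τ (c p)) := fun a b hab => hL <| by
    rw [← hcomp]; simp [hab]
  have hτsurj : Function.Surjective (fderiv ℝ τ (c p)) :=
    (LinearMap.injective_iff_surjective (f := (fderiv ℝ τ (c p)).toLinearMap)).1 hτinj
  intro a b hab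
  obtain ⟨a, rfl⟩ := hτsurj a
  obtain ⟨b, rfl⟩ := hτsurj b
  have : L a = L b := by rw [← hcomp]; simp [hab]
  rw [hL this]

theorem differential_tangentLift (φ : M → Euc d) (p : M) (V : Euc d) :
    differential (n := n) φ p (tangentLift (n := n) φ p V) =
      (tangentSpace (n := n) φ p).starProjection V :=
  Classical.choose_spec
    (LinearMap.mem_range.1 ((tangentSpace (n := n) φ p).starProjection_apply_mem V))

/-- The normal projection is self-adjoint, so it can be moved onto `e_l`; this produces the `ν` to
which the principal curvature argument applies. -/
theorem secondFundamentalForm_apply_coord {φ : M → Euc d} {p : M}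
    (hφ : ContDiffAt ℝ ∞ (localParam φ p) (extChartAt (𝓡 n) p p)) (V W : Euc d) (l : Fin d) :
    secondFundamentalForm (n := n) φ p V W l =
      inner ℝ ((tangentSpace (n := n) φ p)ᗮ.starProjection (EuclideanSpace.single l 1))
        (fderiv ℝ (fderiv ℝ (localParam φ p)) (extChartAt (𝓡 n) p p)
          (tangentLift (n := n) φ p V) (tangentLift (n := n) φ p W)) := by
  have h1 : HasFDerivAt (fderiv ℝ (localParam φ p)) _ (extChartAt (𝓡 n) p p) :=
    ((hφ.fderiv_right (m := ∞) (by simp)).differentiableAt (by simp)).hasFDerivAt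
  have h2 := (h1.clm_apply (hasFDerivAt_const (tangentLift (n := n) φ p W) _)).fderiv
  rw [secondFundamentalForm, h2, Submodule.inner_starProjection_left_eq_right]
  simp [EuclideanSpace.inner_single_left]

theorem inner_starProjection_orthogonal_differential (φ : M → Euc d) (p : M) (V : Euc d)
    (w : Euc n) : inner ℝ ((tangentSpace (n := n) φ p)ᗮ.starProjection V)
      (differential (n := n) φ p w) = 0 :=
  Submodule.inner_left_of_mem_orthogonal (K := tangentSpace (n := n) φ p) ⟨w, rfl⟩
    (Submodule.starProjection_apply_mem _ V)

/-- The potential is smooth near a point of an embedded submanifold, and its derivatives in one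
principal tangent direction (twice) and a normal direction (`j` times) are powers of the
principal curvature. -/
theorem potential_properties [IsManifold (𝓡 n) ∞ M] {φ : M → Euc d}
    (hφ : Manifold.IsSmoothEmbedding (𝓡 n) 𝓘(ℝ, Euc d) ∞ φ) (p : M) :
    (∀ᶠ y in 𝓝 (φ p), ContDiffAt ℝ ∞ (potential (range φ)) y) ∧
    ∀ (ν : Euc d) (a : Euc n) (l : ℝ) (j : ℕ),
      (∀ w, inner ℝ ν (differential (n := n) φ p w) = 0) →
      (∀ w, inner ℝ ν (fderiv ℝ (fderiv ℝ (localParam φ p)) (extChartAt (𝓡 n) p p) w a) =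
        l * inner ℝ (differential (n := n) φ p w) (differential (n := n) φ p a)) →
      ‖ν‖ ≤ 1 → ‖differential (n := n) φ p a‖ = 1 →
      (j.factorial * l ^ j) ^ 2 ≤ derivTensorNormSq (range φ) (j + 2) (φ p) := by
  have hψ := eventually_contDiffAt_localParam hφ.contMDiff p
  have hinj : Function.Injective (fderiv ℝ (localParam φ p) (extChartAt (𝓡 n) p p)) :=
    injective_differential (hφ.isImmersion.isImmersionAt p)
      (hψ.self_of_nhds.differentiableAt (by simp))
  obtain ⟨g, hg0, hg, huniq⟩ := exists_criticalPoint hψ hinj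
  have hdist := eventually_infDist_eq (S := range φ) hψ (Eventually.of_forall fun u => ⟨_, rfl⟩)
    (fun V hV => image_localParam_mem_nhdsWithin hφ.isEmbedding p hV) huniq
  have hgc : ContinuousAt g _ := hg.self_of_nhds.1.continuousAt
  rw [ContinuousAt, hg0] at hgc
  have hψg := hgc.eventually hψ
  have hsmooth := eventually_contDiffAt_potential hψg (hg.mono fun y h => h.1) hdist
  have hx := localParam_extChartAt_self (n := n) φ p
  refine ⟨hx ▸ hsmooth, fun ν a l j hν hl hν1 ha => ?_⟩
  have hh := eventually_hessian_potential hψg (hg.mono fun y h => h.1) (hg.mono fun y h => h.2)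
    huniq hdist hν hl
  have hval := (eventually_iteratedFDeriv_line hsmooth hh j).self_of_nhds
  have ha' : ‖fderiv ℝ (localParam φ p) (extChartAt (𝓡 n) p p) a‖ = 1 := ha
  rw [zero_smul, add_zero, hx, ha'] at hval
  simp only [one_pow, mul_one, zero_mul, sub_zero, div_one] at hval
  rw [← hval]
  refine sq_apply_le_sum_sq_apply_single _ _ fun i => ?_
  split_ifs
  · exact hν1
  · exact ha'.le

theorem secondFundamentalForm_pow_le [IsManifold (𝓡 n) ∞ M] {φ : M → Euc d}
    (hφ : Manifold.IsSmoothEmbedding (𝓡 n) 𝓘(ℝ, Euc d) ∞ φ) (p : M) (j : ℕ) (i₁ i₂ i₃ : Fin d) :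
    (secondFundamentalForm (n := n) φ p (EuclideanSpace.single i₁ 1)
      (EuclideanSpace.single i₂ 1) i₃ ^ 2) ^ (j + 1) ≤
      ((n : ℝ) ^ 2) ^ (j + 1) * derivTensorNormSq (range φ) (j + 3) (φ p) := by
  have hnn : 0 ≤ derivTensorNormSq (range φ) (j + 3) (φ p) :=
    Finset.sum_nonneg fun i _ => sq_nonneg _
  have hψ := (eventually_contDiffAt_localParam hφ.contMDiff p).self_of_nhds
  have hinj : Function.Injective (differential (n := n) φ p) :=
    injective_differential (hφ.isImmersion.isImmersionAt p) (hψ.differentiableAt (by simp))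
  set u₀ := extChartAt (𝓡 n) p p
  by_cases hne : secondFundamentalForm (n := n) φ p (EuclideanSpace.single i₁ 1)
      (EuclideanSpace.single i₂ 1) i₃ = 0
  · rw [hne, zero_pow two_ne_zero, zero_pow (Nat.succ_ne_zero j)]
    positivity
  set ν := (tangentSpace (n := n) φ p)ᗮ.starProjection (EuclideanSpace.single i₃ (1 : ℝ))
  have hν1 : ‖ν‖ ≤ 1 := by
    refine (Submodule.norm_starProjection_apply_le _ _).trans ?_
    simp
  have hnorm : ∀ i : Fin d, ‖(differential (n := n) φ p).toLinearMap
      (tangentLift (n := n) φ p (EuclideanSpace.single i 1))‖ ≤ 1 := fun i => by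
    rw [ContinuousLinearMap.coe_coe, differential_tangentLift]
    refine (Submodule.norm_starProjection_apply_le _ _).trans ?_
    simp
  have hsymm : IsSymmSndFDerivAt ℝ (localParam φ p) u₀ := hψ.isSymmSndFDerivAt (by
    simpa using ENat.natCast_le_of_coe_top_le_withTop le_rfl 2)
  let b : Euc n →ₗ[ℝ] Euc n →ₗ[ℝ] ℝ := LinearMap.mk₂ ℝ
    (fun w w' => inner ℝ ν (fderiv ℝ (fderiv ℝ (localParam φ p)) u₀ w w'))
    (by simp [inner_add_right]) (by simp [inner_smul_right]) (by simp [inner_add_right])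
    (by simp [inner_smul_right])
  rw [secondFundamentalForm_apply_coord hψ] at hne ⊢
  obtain ⟨a, l, ha, hl, hle⟩ := exists_eigenvector_abs_le (differential (n := n) φ p).toLinearMap
    hinj b (fun w w' => by simp only [b, LinearMap.mk₂_apply]; rw [hsymm.eq]) (hnorm i₁) (hnorm i₂)
    hne
  have hmain := (potential_properties hφ p).2 ν a l (j + 1)
    (inner_starProjection_orthogonal_differential φ p _) hl hν1 ha
  rw [finrank_euclideanSpace_fin] at hle
  have hfac : (1 : ℝ) ≤ (j + 1).factorial := by exact_mod_cast (j + 1).factorial_pos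
  have h1 : (l ^ 2) ^ (j + 1) ≤ derivTensorNormSq (range φ) (j + 3) (φ p) := by
    refine le_trans ?_ hmain
    rw [mul_pow, ← pow_mul, ← pow_mul, mul_comm (j + 1) 2]
    exact le_mul_of_one_le_left (by rw [pow_mul]; positivity) (one_le_pow₀ hfac)
  have h2 : (b (tangentLift (n := n) φ p (EuclideanSpace.single i₁ 1))
      (tangentLift (n := n) φ p (EuclideanSpace.single i₂ 1))) ^ 2 ≤ (n : ℝ) ^ 2 * l ^ 2 := by
    rw [← sq_abs, ← sq_abs l, ← mul_pow]
    gcongr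
  calc _ ≤ ((n : ℝ) ^ 2 * l ^ 2) ^ (j + 1) := by gcongr; exact h2
    _ ≤ _ := by rw [mul_pow]; gcongr

theorem exists_isOpen_contDiffOn_potential [IsManifold (𝓡 n) ∞ M] {φ : M → Euc d}
    (hφ : Manifold.IsSmoothEmbedding (𝓡 n) 𝓘(ℝ, Euc d) ∞ φ) :
    ∃ Ω : Set (Euc d), IsOpen Ω ∧ range φ ⊆ Ω ∧ ContDiffOn ℝ ∞ (potential (range φ)) Ω := by
  refine ⟨interior {y | ContDiffAt ℝ ∞ (potential (range φ)) y}, isOpen_interior, ?_,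
    fun y hy => ContDiffAt.contDiffWithinAt (by simpa using interior_subset hy)⟩
  rintro _ ⟨p, rfl⟩
  exact mem_interior_iff_mem_nhds.2 (potential_properties hφ p).1

theorem one_le_derivTensorNormSq_two [IsManifold (𝓡 n) ∞ M] {φ : M → Euc d}
    (hφ : Manifold.IsSmoothEmbedding (𝓡 n) 𝓘(ℝ, Euc d) ∞ φ) (p : M) (hn : 1 ≤ n) :
    1 ≤ derivTensorNormSq (range φ) 2 (φ p) := by
  have hinj : Function.Injective (differential (n := n) φ p) :=
    injective_differential (hφ.isImmersion.isImmersionAt p)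
      ((eventually_contDiffAt_localParam hφ.contMDiff p).self_of_nhds.differentiableAt (by simp))
  set e : Euc n := EuclideanSpace.single ⟨0, hn⟩ 1
  have he : differential (n := n) φ p e ≠ 0 := fun h =>
    one_ne_zero (α := ℝ) (by
      have := congrArg (‖·‖) ((injective_iff_map_eq_zero _).1 hinj e h)
      simp [e] at this)
  have hunit : ‖differential (n := n) φ p (‖differential (n := n) φ p e‖⁻¹ • e)‖ = 1 := by
    rw [map_smul, norm_smul, norm_inv, norm_norm, inv_mul_cancel₀ (norm_ne_zero_iff.2 he)]
  -- With `ν = 0`, `l = 0`, `j = 0` no curvature is involved, and the bound is `(0! · 0^0)² = 1`.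
  simpa using (potential_properties hφ p).2 0 _ 0 0 (by simp) (by simp) (by simp) hunit

theorem secondFundamentalFormNorm_pow_le [IsManifold (𝓡 n) ∞ M] {φ : M → Euc d}
    (hφ : Manifold.IsSmoothEmbedding (𝓡 n) 𝓘(ℝ, Euc d) ∞ φ) (p : M) (j : ℕ) :
    secondFundamentalFormNorm n φ p ^ (2 * (j + 1)) ≤
      ((d : ℝ) ^ 3 * n ^ 2) ^ (j + 1) * derivTensorNormSq (range φ) (j + 3) (φ p) := by
  let f : Fin d × Fin d × Fin d → ℝ := fun q =>
    secondFundamentalForm (n := n) φ p (EuclideanSpace.single q.1 1)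
      (EuclideanSpace.single q.2.1 1) q.2.2 ^ 2
  have hf : secondFundamentalFormNorm n φ p ^ 2 = ∑ q, f q := by
    rw [secondFundamentalFormNorm, Real.sq_sqrt (by positivity)]
    simp only [f, Fintype.sum_prod_type]
  rw [pow_mul, hf]
  -- Power mean inequality over `d³` components: a factor `(d³)^j`, and one more `d³` from the sum
  -- below.
  refine (pow_sum_le_card_mul_sum_pow (fun q _ => sq_nonneg _) j).trans ?_
  have hsum := Finset.sum_le_card_nsmul Finset.univ (fun q => f q ^ (j + 1)) _ fun q _ =>
    secondFundamentalForm_pow_le hφ p j q.1 q.2.1 q.2.2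
  refine (mul_le_mul_of_nonneg_left hsum (by positivity)).trans_eq ?_
  simp only [Finset.card_univ, Fintype.card_prod, Fintype.card_fin, nsmul_eq_mul]
  push_cast
  ring

theorem exists_secondFundamentalFormNorm_pow_le (n m : ℕ) {k : ℕ} (hk : 2 ≤ k)
    (hn : k = 2 → 1 ≤ n) :
    ∃ C : ℝ, 0 < C ∧ ∀ (M : Type*) [TopologicalSpace M] [ChartedSpace (Euc n) M]
      [IsManifold (𝓡 n) ∞ M] (φ : M → Euc (n + m)),
      Manifold.IsSmoothEmbedding (𝓡 n) 𝓘(ℝ, Euc (n + m)) ∞ φ →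
      ∀ p : M, C * secondFundamentalFormNorm n φ p ^ (2 * k - 4) ≤
        derivTensorNormSq (range φ) k (φ p) := by
  obtain rfl | hk3 := hk.eq_or_lt
  · refine ⟨1, one_pos, fun M _ _ _ φ hφ p => ?_⟩
    simpa using one_le_derivTensorNormSq_two hφ p (hn rfl)
  · obtain ⟨j, rfl⟩ : ∃ j, k = j + 3 := ⟨k - 3, by omega⟩
    set c : ℝ := (((n + m : ℕ) : ℝ) ^ 3 * n ^ 2) ^ (j + 1)
    have hc : 0 ≤ c := by positivity
    -- The `+ 1` keeps the constant positive when `n = 0`, where `c = 0`.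
    refine ⟨(c + 1)⁻¹, by positivity, fun M _ _ _ φ hφ p => ?_⟩
    have hnn : 0 ≤ derivTensorNormSq (range φ) (j + 3) (φ p) :=
      Finset.sum_nonneg fun i _ => sq_nonneg _
    rw [inv_mul_le_iff₀ (by positivity), show 2 * (j + 3) - 4 = 2 * (j + 1) by omega]
    refine (secondFundamentalFormNorm_pow_le hφ p j).trans ?_
    gcongr
    exact (lt_add_one c).le

end

end SqDist

theorem mainTheorem4 (n m k : ℕ) (hk : 2 ≤ k) (hn : k = 2 → 1 ≤ n) :
    ∃ C : ℝ, 0 < C ∧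
      ∀ (M : Type*) [TopologicalSpace M] [ChartedSpace (SqDist.Euc n) M]
        [IsManifold (𝓡 n) ∞ M] (φ : M → SqDist.Euc (n + m)),
        Manifold.IsSmoothEmbedding (𝓡 n) 𝓘(ℝ, SqDist.Euc (n + m)) ∞ φ →
          (∃ Ω : Set (SqDist.Euc (n + m)), IsOpen Ω ∧ Set.range φ ⊆ Ω ∧
            ContDiffOn ℝ ∞ (SqDist.potential (Set.range φ)) Ω) ∧
          ∀ p : M, C * SqDist.secondFundamentalFormNorm n φ p ^ (2 * k - 4) ≤
            SqDist.derivTensorNormSq (Set.range φ) k (φ p) := by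
  obtain ⟨C, hC, hbound⟩ := SqDist.exists_secondFundamentalFormNorm_pow_le n m hk hn
  exact ⟨C, hC, fun M _ _ _ φ hφ =>
    ⟨SqDist.exists_isOpen_contDiffOn_potential hφ, hbound M φ hφ⟩⟩
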